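/- Write $\mathbb N=\{1,2,3,\dots\}$. For $d>1$, a *$d$-decaying system* is a sequence of $C^1$ maps $f_i:[0,1]\to[0,1]$ $(i\in\mathbb N)$ such that (1) there are $m\in\mathbb N$ and $0<A<1$ with $0<|(f_{a_1}\circ\cdots\circ f_{a_m})'(x)|\le A$ for all $(a_1,\dots,a_m)\in\mathbb N^m$ and $x\in[0,1]$; (2) $f_i((0,1))\cap f_j((0,1))=\emptyset$ for $i\ne j$; (3) for every $\varepsilon>0$ there are $C_1,C_2>0$ such that for every $i\in\mathbb N$ there are constants $\xi_i,\lambda_i$ with $\xi_i\le|f_i'(x)|\le\lambda_i$ for all $x\in[0,1]$ and $C_1 i^{-(d+\varepsilon)}\le\xi_i\le\lambda_i\le C_2 i^{-(d-\varepsilon)}$. For $\Phi:\mathbb N\to\mathbb R$ let $X_\Phi$ be the set of all points $\lim_{n\to\infty}f_{a_1}\circ\cdots\circ f_{a_n}(1)$ where $(a_n)\in\mathbb N^{\mathbb N}$ satisfies $a_{n+1}>\Phi(a_n)$ for all $n$. **Theorem.** For any $d>1$ and any strictly increasing $\Phi:\mathbb N\to\mathbb N$ there is a $d$-decaying system $(f_i)_{i\in\mathbb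 N}$ such that $$\dim_H X_\Phi=\frac1d .$$ The system can be chosen piecewise linear with gaps between the first-level cylinders: there are $C>0$ and $b_i\in\mathbb R$ with $f_i(x)=C i^{-d}x+b_i$ on $[0,1]$, the interval $f_{i+1}([0,1])$ lies to the left of $f_i([0,1])$ for every $i$ (common endpoints allowed), and for infinitely many $i$ these two intervals are separated by an interval of positive length. In particular, for all $d>1$ and $\alpha>1$ there is a $d$-decaying system of this form, with gaps, such that for $\Phi(n)=n^\alpha$ $$\dim_H X_\Phi\neq\frac1{1+\alpha(d-1)},$$ where the right-hand side is the dimension which holds for Gauss-like systems (those whose first-level cylinders are ordered from right to left and fill $[0,1]$ without gaps). -/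

import Mathlib

open Set Filter Topology

namespace DecayingIFS

/-- The composition `f_{a 0} ∘ f_{a 1} ∘ ⋯ ∘ f_{a (n-1)}` of the first `n` maps chosen by the
sequence `a` (the digits `a_1, a_2, …` are `a 0, a 1, …`). -/
def comp (f : ℕ+ → ℝ → ℝ) (a : ℕ → ℕ+) : ℕ → ℝ → ℝ
  | 0 => id
  | n + 1 => comp f a n ∘ f (a n)

/-- A `d`-decaying system: `C¹` maps `f_i : [0,1] → [0,1]`, `i = 1, 2, …`, with uniform
contraction of all `m`-fold compositions for some `m`, pairwise disjoint images of `(0,1)`,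
and derivatives of size `i ^ (-d)` up to arbitrarily small powers of `i`.
Only the values of the maps on `[0,1]` matter, and derivatives are taken within `[0,1]`.
Words of length `m` are given as the first `m` terms of a sequence. -/
structure IsDecaying (d : ℝ) (f : ℕ+ → ℝ → ℝ) : Prop where
  one_lt : 1 < d
  mapsTo : ∀ i, MapsTo (f i) (Icc 0 1) (Icc 0 1)
  contDiffOn : ∀ i, ContDiffOn ℝ 1 (f i) (Icc 0 1)
  contracting : ∃ m : ℕ, 0 < m ∧ ∃ A : ℝ, 0 < A ∧ A < 1 ∧
    ∀ a : ℕ → ℕ+, ∀ x ∈ Icc (0 : ℝ) 1,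
      0 < |derivWithin (comp f a m) (Icc 0 1) x| ∧ |derivWithin (comp f a m) (Icc 0 1) x| ≤ A
  disjoint : ∀ i j, i ≠ j → f i '' Ioo 0 1 ∩ f j '' Ioo 0 1 = ∅
  decay : ∀ ε : ℝ, 0 < ε → ∃ C₁ C₂ : ℝ, 0 < C₁ ∧ 0 < C₂ ∧ ∀ i : ℕ+, ∃ ξ lam : ℝ,
    (∀ x ∈ Icc (0 : ℝ) 1,
      ξ ≤ |derivWithin (f i) (Icc 0 1) x| ∧ |derivWithin (f i) (Icc 0 1) x| ≤ lam) ∧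
    C₁ / ((i : ℕ) : ℝ) ^ (d + ε) ≤ ξ ∧ ξ ≤ lam ∧ lam ≤ C₂ / ((i : ℕ) : ℝ) ^ (d - ε)

/-- The point `x` is coded by the digit sequence `a`:
`x = lim_n (f_{a 0} ∘ ⋯ ∘ f_{a (n-1)}) 1`, the limit being required to exist. -/
def Codes (f : ℕ+ → ℝ → ℝ) (a : ℕ → ℕ+) (x : ℝ) : Prop :=
  Tendsto (fun n => comp f a n 1) atTop (𝓝 x)

/-- The set `X_Φ` of points with a digit sequence satisfying `a_{n+1} > Φ (a_n)` for all `n`. -/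
def growthSet (f : ℕ+ → ℝ → ℝ) (Φ : ℕ+ → ℝ) : Set ℝ :=
  {x | ∃ a : ℕ → ℕ+, (∀ n, Φ (a n) < ((a (n + 1) : ℕ) : ℝ)) ∧ Codes f a x}

/-- The maps are affine on `[0,1]`, of the form `f_i x = C i ^ (-d) x + b_i` with `C > 0`. -/
def IsPowerAffine (d : ℝ) (f : ℕ+ → ℝ → ℝ) : Prop :=
  ∃ C : ℝ, 0 < C ∧ ∃ b : ℕ+ → ℝ, ∀ i : ℕ+, ∀ x ∈ Icc (0 : ℝ) 1,
    f i x = C / ((i : ℕ) : ℝ) ^ d * x + b i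

/-- The first-level cylinders `f_i [0,1]` are ordered from right to left, and for infinitely many
`i` there is a nondegenerate gap between the neighbours `f_{i+1} [0,1]` and `f_i [0,1]`. -/
def HasGaps (f : ℕ+ → ℝ → ℝ) : Prop :=
  (∀ i : ℕ+, ∀ x ∈ Icc (0 : ℝ) 1, ∀ y ∈ Icc (0 : ℝ) 1, f (i + 1) x ≤ f i y) ∧
  ∀ N : ℕ+, ∃ i : ℕ+, N ≤ i ∧ ∃ u v : ℝ, u < v ∧
    (∀ x ∈ Icc (0 : ℝ) 1, f (i + 1) x ≤ u) ∧ (∀ y ∈ Icc (0 : ℝ) 1, v ≤ f i y)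

end DecayingIFS

open MeasureTheory

namespace DecayingIFS

theorem comp_congr {f : ℕ+ → ℝ → ℝ} {a a' : ℕ → ℕ+} {n : ℕ} (h : ∀ k < n, a k = a' k) :
    comp f a n = comp f a' n := by
  induction n with
  | zero => rfl
  | succ n ih =>
    simp only [comp]
    rw [ih fun k hk => h k (hk.trans n.lt_succ_self), h n n.lt_succ_self]

section Affine

variable {f : ℕ+ → ℝ → ℝ} {r b : ℕ+ → ℝ}

theorem comp_sub (hf : ∀ i x, f i x = r i * x + b i) (a : ℕ → ℕ+) (n : ℕ) (x y : ℝ) :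
    comp f a n x - comp f a n y = (∏ k ∈ Finset.range n, r (a k)) * (x - y) := by
  induction n generalizing x y with
  | zero => simp [comp]
  | succ n ih =>
    simp only [comp, Function.comp_apply]
    rw [ih, Finset.prod_range_succ, hf, hf]
    ring

theorem continuous_comp (hf : ∀ i x, f i x = r i * x + b i) (a : ℕ → ℕ+) (n : ℕ) :
    Continuous (comp f a n) := by
  induction n with
  | zero => exact continuous_id
  | succ n ih =>
    refine ih.comp ?_
    rw [show f (a n) = fun x => r (a n) * x + b (a n) from funext (hf _)]
    fun_prop

theorem comp_image_antitone (hm : ∀ i, MapsTo (f i) (Icc 0 1) (Icc 0 1)) (a : ℕ → ℕ+) :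
    Antitone fun n => comp f a n '' Icc 0 1 := by
  refine antitone_nat_of_succ_le fun n => ?_
  rintro _ ⟨x, hx, rfl⟩
  exact ⟨f (a n) x, hm _ hx, rfl⟩

theorem Codes.mem_image (hf : ∀ i x, f i x = r i * x + b i)
    (hm : ∀ i, MapsTo (f i) (Icc 0 1) (Icc 0 1)) {a : ℕ → ℕ+} {x : ℝ} (h : Codes f a x) (n : ℕ) :
    x ∈ comp f a n '' Icc 0 1 := by
  refine (isCompact_Icc.image (continuous_comp hf a n)).isClosed.mem_of_tendsto h ?_
  filter_upwards [eventually_ge_atTop n] with N hN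
  exact comp_image_antitone hm a hN ⟨1, by simp, rfl⟩

theorem prod_ratio_le (h0 : ∀ i, 0 ≤ r i) (h2 : ∀ i, r i ≤ 1 / 2) (a : ℕ → ℕ+) (n : ℕ) :
    ∏ k ∈ Finset.range n, r (a k) ≤ (1 / 2) ^ n := by
  refine (Finset.prod_le_prod (fun k _ => h0 _) fun k _ => h2 _).trans ?_
  simp

theorem exists_codes (hf : ∀ i x, f i x = r i * x + b i)
    (hm : ∀ i, MapsTo (f i) (Icc 0 1) (Icc 0 1)) (h0 : ∀ i, 0 ≤ r i) (h2 : ∀ i, r i ≤ 1 / 2)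
    (a : ℕ → ℕ+) : ∃ x, Codes f a x := by
  refine cauchySeq_tendsto_of_complete (cauchySeq_of_le_geometric (1 / 2) 1 (by norm_num) ?_)
  intro n
  have hp : 0 ≤ ∏ k ∈ Finset.range n, r (a k) := Finset.prod_nonneg fun k _ => h0 _
  have h1 := hm (a n) (x := 1) (by simp)
  simp only [comp, Function.comp_apply]
  rw [Real.dist_eq, comp_sub hf, abs_mul, abs_of_nonneg hp, mul_comm]
  refine mul_le_mul ?_ (prod_ratio_le h0 h2 a n) hp zero_le_one
  rw [abs_le]
  constructor <;> linarith [h1.1, h1.2]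

/-- Two points whose codes first differ at position `n` are separated by the gap between the
corresponding first-level cylinders, scaled by the ratio of the common cylinder. -/
theorem codes_sub_ge (hf : ∀ i x, f i x = r i * x + b i)
    (hm : ∀ i, MapsTo (f i) (Icc 0 1) (Icc 0 1)) (h0 : ∀ i, 0 ≤ r i)
    {a a' : ℕ → ℕ+} {x x' : ℝ} (hx : Codes f a x) (hx' : Codes f a' x') {n : ℕ}
    (h : ∀ k < n, a k = a' k) :
    (∏ k ∈ Finset.range n, r (a k)) * (b (a n) - (r (a' n) + b (a' n))) ≤ x - x' := by
  obtain ⟨u, hu, rfl⟩ := hx.mem_image hf hm (n + 1)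
  obtain ⟨v, hv, rfl⟩ := hx'.mem_image hf hm (n + 1)
  simp only [comp, Function.comp_apply]
  rw [← comp_congr h, comp_sub hf]
  refine mul_le_mul_of_nonneg_left ?_ (Finset.prod_nonneg fun k _ => h0 _)
  rw [hf, hf]
  nlinarith [mul_nonneg (h0 (a n)) hu.1, mul_nonneg (h0 (a' n)) (sub_nonneg.2 hv.2)]

end Affine

theorem tsum_pi_fin_prod {ι : Type*} (n : ℕ) (u : ℕ → ι → ENNReal) :
    ∑' w : Fin n → ι, ∏ k : Fin n, u k (w k) = ∏ k ∈ Finset.range n, ∑' i, u k i := by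
  induction n generalizing u with
  | zero => simp
  | succ n ih =>
    rw [← (Fin.consEquiv fun _ : Fin (n + 1) => ι).tsum_eq, Finset.prod_range_succ']
    simp only [Fin.consEquiv, Equiv.coe_fn_mk, Fin.prod_univ_succ, Fin.cons_zero, Fin.cons_succ,
      Fin.val_zero, Fin.val_succ]
    rw [ENNReal.tsum_prod (f := fun i (w : Fin n → ι) => u 0 i * ∏ k : Fin n, u (k + 1) (w k))]
    simp_rw [ENNReal.tsum_mul_left, ih fun k => u (k + 1), ENNReal.tsum_mul_right]
    rw [mul_comm]

theorem tendsto_prod_range_zero {v : ℕ → ENNReal} (hv : ∀ n, v n ≠ ⊤)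
    (h : Tendsto v atTop (𝓝 0)) :
    Tendsto (fun n => ∏ k ∈ Finset.range n, v k) atTop (𝓝 0) := by
  have hhalf : (0 : ENNReal) < 1 / 2 := by simp
  obtain ⟨N, hN⟩ := (eventually_atTop.1 (h.eventually (gt_mem_nhds hhalf)))
  rw [← tendsto_add_atTop_iff_nat N]
  have hle : ∀ m, ∏ k ∈ Finset.range (m + N), v k
      ≤ (∏ k ∈ Finset.range N, v k) * (1 / 2) ^ m := by
    intro m
    rw [add_comm, Finset.prod_range_add]
    gcongr
    refine (Finset.prod_le_prod' fun k _ => (hN (N + k) (by omega)).le).trans ?_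
    simp
  refine tendsto_of_tendsto_of_tendsto_of_le_of_le tendsto_const_nhds ?_ (fun _ => bot_le) hle
  have := ENNReal.Tendsto.const_mul (a := ∏ k ∈ Finset.range N, v k)
    (ENNReal.tendsto_pow_atTop_nhds_zero_of_lt_one (r := 1 / 2) (by simp))
    (Or.inr (ENNReal.prod_ne_top fun k _ => hv k))
  simpa using this

/-- The coded points whose digits grow at least linearly form a null set for the `s`-dimensional
Hausdorff measure as soon as the `s`-th powers of the ratios are summable. -/
theorem hausdorffMeasure_growing_eq_zero {f : ℕ+ → ℝ → ℝ} {r b : ℕ+ → ℝ}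
    (hf : ∀ i x, f i x = r i * x + b i)
    (hm : ∀ i, MapsTo (f i) (Icc 0 1) (Icc 0 1)) (h0 : ∀ i, 0 ≤ r i) (h2 : ∀ i, r i ≤ 1 / 2)
    {s : ℝ} (hs : 0 < s) (hsum : Summable fun i => r i ^ s) :
    μH[s] {x : ℝ | ∃ a : ℕ → ℕ+, (∀ k, k < (a k : ℕ)) ∧ Codes f a x} = 0 := by
  set Y := {x : ℝ | ∃ a : ℕ → ℕ+, (∀ k, k < (a k : ℕ)) ∧ Codes f a x}
  let t : ∀ n : ℕ, (Fin n → ℕ+) → Set ℝ := fun n w =>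
    {x | ∃ a : ℕ → ℕ+, (∀ k, k < (a k : ℕ)) ∧ (∀ k : Fin n, a k = w k) ∧ Codes f a x}
  let u : ℕ → ℕ+ → ENNReal := fun k i => if k < (i : ℕ) then ENNReal.ofReal (r i) ^ s else 0
  have hdiam : ∀ n w, Metric.ediam (t n w) ≤ ∏ k : Fin n, ENNReal.ofReal (r (w k)) := by
    intro n w
    refine Metric.ediam_le ?_
    rintro x ⟨a, -, haw, hx⟩ y ⟨a', -, haw', hy⟩
    have hc : ∀ k < n, a' k = a k := fun k hk => (haw' ⟨k, hk⟩).trans (haw ⟨k, hk⟩).symm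
    obtain ⟨p, hp, rfl⟩ := hx.mem_image hf hm n
    obtain ⟨q, hq, rfl⟩ := hy.mem_image hf hm n
    have hp0 : 0 ≤ ∏ k ∈ Finset.range n, r (a k) := Finset.prod_nonneg fun k _ => h0 _
    rw [comp_congr hc, edist_dist, Real.dist_eq, comp_sub hf,
      ← ENNReal.ofReal_prod_of_nonneg fun k _ => h0 _]
    refine ENNReal.ofReal_le_ofReal ?_
    rw [abs_mul, abs_of_nonneg hp0, ← Finset.prod_congr rfl fun k _ => congrArg r (haw k),
      Fin.prod_univ_eq_prod_range (fun k => r (a k))]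
    refine mul_le_of_le_one_right hp0 ?_
    rw [abs_le]
    constructor <;> linarith [hp.1, hp.2, hq.1, hq.2]
  have hdiam_pow : ∀ n w, Metric.ediam (t n w) ^ s ≤ ∏ k : Fin n, u k (w k) := by
    intro n w
    by_cases hw : ∀ k : Fin n, (k : ℕ) < w k
    · refine (ENNReal.rpow_le_rpow (hdiam n w) hs.le).trans ?_
      rw [← ENNReal.prod_rpow_of_nonneg hs.le]
      exact (Finset.prod_congr rfl fun k _ => (if_pos (hw k)).symm).le
    · push Not at hw
      obtain ⟨k, hk⟩ := hw
      have : t n w = ∅ := by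
        refine eq_empty_of_forall_notMem ?_
        rintro x ⟨a, ha, haw, -⟩
        have := ha k
        rw [haw] at this
        omega
      simp [this, hs]
  have hu : ∑' i, u 0 i ≠ ⊤ := by
    have : ∀ i, u 0 i = ENNReal.ofReal (r i ^ s) := fun i => by
      simp only [u, i.pos, if_true]
      rw [ENNReal.ofReal_rpow_of_nonneg (h0 i) hs.le]
    simp_rw [this]
    exact hsum.tsum_ofReal_ne_top
  have hu_top : ∀ k, ∑' i, u k i ≠ ⊤ := by
    intro k
    refine ne_top_of_le_ne_top hu (ENNReal.tsum_le_tsum fun i => ?_)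
    simp only [u, i.pos, if_true]
    split_ifs <;> simp
  have hu_lim : Tendsto (fun k => ∑' i, u k i) atTop (𝓝 0) := by
    have hnat : ∀ k, ∑' i, u k i = ∑' n : ℕ, u k n.succPNat := fun k =>
      (Equiv.pnatEquivNat.symm.tsum_eq (u k)).symm
    have htail : ∀ k, ∑' i, u k i = ∑' n : ℕ, u 0 (n + k).succPNat := by
      intro k
      rw [hnat, ← ENNReal.summable.sum_add_tsum_nat_add' (k := k),
        Finset.sum_eq_zero, zero_add]
      · refine tsum_congr fun n => ?_
        have h1 : 0 < ((n + k).succPNat : ℕ) := PNat.pos _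
        have h2 : k < ((n + k).succPNat : ℕ) := by rw [Nat.succPNat_coe]; omega
        simp only [u, h1, h2, if_true]
      · intro n hn
        refine if_neg ?_
        have := Finset.mem_range.1 hn
        rw [Nat.succPNat_coe]
        omega
    simp_rw [htail]
    exact ENNReal.tendsto_sum_nat_add (fun n => u 0 n.succPNat) (hnat 0 ▸ hu)
  refine le_antisymm ?_ bot_le
  refine (Measure.hausdorffMeasure_le_liminf_tsum s Y (l := atTop)
    (fun n : ℕ => ENNReal.ofReal ((1 / 2) ^ n))
    ?_ t ?_ ?_).trans ?_
  · rw [← ENNReal.ofReal_zero]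
    exact ENNReal.tendsto_ofReal (tendsto_pow_atTop_nhds_zero_of_lt_one (by norm_num) (by norm_num))
  · refine Eventually.of_forall fun n w => (hdiam n w).trans ?_
    rw [← ENNReal.ofReal_prod_of_nonneg fun k _ => h0 _]
    refine ENNReal.ofReal_le_ofReal ?_
    refine (Finset.prod_le_prod (fun k _ => h0 _) fun k _ => h2 _).trans ?_
    simp
  · refine Eventually.of_forall fun n => ?_
    rintro x ⟨a, ha, hx⟩
    exact mem_iUnion.2 ⟨fun k => a k, a, ha, fun _ => rfl, hx⟩
  · refine (liminf_le_liminf (Eventually.of_forall fun n =>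
      ENNReal.tsum_le_tsum fun w => hdiam_pow n w)).trans ?_
    simp_rw [tsum_pi_fin_prod]
    exact (tendsto_prod_range_zero hu_top hu_lim).liminf_eq.le

end DecayingIFS

namespace DecayingIFS

/-- The remainders of the expansion of `y` in the mixed radix system with bases `M 0, M 1, …`. -/
noncomputable def radixRem (M : ℕ → ℕ) (y : ℝ) : ℕ → ℝ
  | 0 => y
  | n + 1 => Int.fract (M n * radixRem M y n)

/-- The digits of the expansion of `y` in the mixed radix system with bases `M 0, M 1, …`. -/
noncomputable def radixDigit (M : ℕ → ℕ) (y : ℝ) (n : ℕ) : ℕ :=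
  ⌊M n * radixRem M y n⌋₊

theorem radixRem_mem (M : ℕ → ℕ) {y : ℝ} (hy : y ∈ Ico (0 : ℝ) 1) (n : ℕ) :
    radixRem M y n ∈ Ico (0 : ℝ) 1 := by
  cases n with
  | zero => exact hy
  | succ n => exact ⟨Int.fract_nonneg _, Int.fract_lt_one _⟩

theorem radixDigit_lt {M : ℕ → ℕ} {n : ℕ} (hM : 0 < M n) {y : ℝ} (hy : y ∈ Ico (0 : ℝ) 1) :
    radixDigit M y n < M n := by
  have h := radixRem_mem M hy n
  have hM' : (0 : ℝ) < M n := by exact_mod_cast hM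
  rw [radixDigit, Nat.floor_lt (mul_nonneg hM'.le h.1)]
  exact mul_lt_of_lt_one_right hM' h.2

theorem radixDigit_add_rem (M : ℕ → ℕ) {y : ℝ} (hy : y ∈ Ico (0 : ℝ) 1) (n : ℕ) :
    (radixDigit M y n : ℝ) + radixRem M y (n + 1) = M n * radixRem M y n := by
  have h : 0 ≤ M n * radixRem M y n := mul_nonneg (Nat.cast_nonneg _) (radixRem_mem M hy n).1
  rw [radixDigit, natCast_floor_eq_intCast_floor h, radixRem, Int.floor_add_fract]

theorem prod_mul_sub_eq_radixRem {M : ℕ → ℕ} {y y' : ℝ} (hy : y ∈ Ico (0 : ℝ) 1)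
    (hy' : y' ∈ Ico (0 : ℝ) 1) {n : ℕ} (h : ∀ k < n, radixDigit M y k = radixDigit M y' k) :
    (∏ k ∈ Finset.range n, (M k : ℝ)) * (y - y') = radixRem M y n - radixRem M y' n := by
  induction n with
  | zero => simp [radixRem]
  | succ n ih =>
    have h1 := radixDigit_add_rem M hy n
    have h2 := radixDigit_add_rem M hy' n
    have h3 := ih fun k hk => h k (hk.trans n.lt_succ_self)
    rw [h n n.lt_succ_self] at h1
    rw [Finset.prod_range_succ]
    linear_combination (M n : ℝ) * h3 - h1 + h2

theorem exists_radixDigit_ne {M : ℕ → ℕ} (hM : ∀ n, 2 ≤ M n) {y y' : ℝ} (hy : y ∈ Ico (0 : ℝ) 1)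
    (hy' : y' ∈ Ico (0 : ℝ) 1) (h : y ≠ y') : ∃ n, radixDigit M y n ≠ radixDigit M y' n := by
  by_contra! hd
  have hpos : 0 < |y - y'| := abs_pos.2 (sub_ne_zero.2 h)
  obtain ⟨n, hn⟩ := pow_unbounded_of_one_lt (1 / |y - y'|) (one_lt_two)
  rw [div_lt_iff₀ hpos] at hn
  have h1 : (2 : ℝ) ^ n ≤ ∏ k ∈ Finset.range n, (M k : ℝ) := by
    calc (2 : ℝ) ^ n = ∏ _k ∈ Finset.range n, (2 : ℝ) := by simp
      _ ≤ _ := Finset.prod_le_prod (fun _ _ => zero_le_two) fun k _ => by exact_mod_cast hM k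
  have h2 := congrArg abs (prod_mul_sub_eq_radixRem (n := n) hy hy' fun k _ => hd k)
  rw [abs_mul, abs_of_nonneg (Finset.prod_nonneg fun _ _ => Nat.cast_nonneg _)] at h2
  have h3 : |radixRem M y n - radixRem M y' n| ≤ 1 := by
    have := radixRem_mem M hy n
    have := radixRem_mem M hy' n
    simp only [mem_Ico] at *
    rw [abs_le]
    constructor <;> linarith
  nlinarith

/-- If the gap between two first-level cylinders of the `n`-th block `(M n, 2 * M n]` is comparable
to the difference of their indices, then the points whose `n`-th digit lies in the `n`-th block
form a set that maps onto `[0,1)` by a Hölder map. -/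
theorem ofReal_le_dimH_of_block_gaps {f : ℕ+ → ℝ → ℝ} {r b : ℕ+ → ℝ}
    (hf : ∀ i x, f i x = r i * x + b i)
    (hm : ∀ i, MapsTo (f i) (Icc 0 1) (Icc 0 1)) (h0 : ∀ i, 0 ≤ r i) (h2 : ∀ i, r i ≤ 1 / 2)
    {M : ℕ → ℕ} (hM : ∀ n, 2 ≤ M n) {ℓ ρ : ℕ → ℝ} (hℓ : ∀ n, 0 ≤ ℓ n) (hρ : ∀ n, 0 ≤ ρ n)
    (hρr : ∀ n, ∀ i : ℕ+, M n < i → i ≤ 2 * M n → ρ n ≤ r i)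
    (hgap : ∀ n, ∀ i j : ℕ+, M n < i → i < j → j ≤ 2 * M n →
      ℓ n * (((j : ℕ) - (i : ℕ) : ℝ) / M n) ≤ b i - (r j + b j))
    {s c : ℝ} (hs : 0 < s) (hs1 : s ≤ 1) (hc : 0 < c)
    (hprod : ∀ n, c ≤ (ℓ n * ∏ k ∈ Finset.range n, ρ k) ^ s * ∏ k ∈ Finset.range n, (M k : ℝ)) :
    ENNReal.ofReal s ≤
      dimH {x : ℝ | ∃ a : ℕ → ℕ+, (∀ n, M n < a n ∧ a n ≤ 2 * M n) ∧ Codes f a x} := by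
  let a : ℝ → ℕ → ℕ+ := fun y n => (M n + radixDigit M y n).succPNat
  have ha : ∀ y n, ((a y n : ℕ+) : ℕ) = M n + radixDigit M y n + 1 := fun y n =>
    Nat.succPNat_coe _
  choose X hX using fun y => exists_codes hf hm h0 h2 (a y)
  have hblock : ∀ y ∈ Ico (0 : ℝ) 1, ∀ n, M n < a y n ∧ a y n ≤ 2 * M n := by
    intro y hy n
    have := radixDigit_lt (n := n) (by linarith [hM n]) hy
    rw [ha]
    omega
  have key : ∀ y ∈ Ico (0 : ℝ) 1, ∀ y' ∈ Ico (0 : ℝ) 1, ∀ n,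
      (∀ k < n, radixDigit M y k = radixDigit M y' k) → radixDigit M y n < radixDigit M y' n →
      |y - y'| ≤ 2 / c * |X y - X y'| ^ s := by
    intro y hy y' hy' n hn hlt
    have hMn : (0 : ℝ) < M n := by have := hM n; positivity
    have hP : 0 < ∏ k ∈ Finset.range n, (M k : ℝ) :=
      Finset.prod_pos fun k _ => by have := hM k; positivity
    set P := ∏ k ∈ Finset.range n, (M k : ℝ)
    set Q := ∏ k ∈ Finset.range n, ρ k
    have hQ : 0 ≤ Q := Finset.prod_nonneg fun k _ => hρ k
    set t : ℝ := (radixDigit M y' n : ℝ) - radixDigit M y n with ht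
    have ht1 : 1 ≤ t := by
      have : (radixDigit M y n : ℝ) + 1 ≤ radixDigit M y' n := by exact_mod_cast hlt
      linarith
    have htM : t / M n ≤ 1 := by
      rw [div_le_one hMn]
      have h1 := radixDigit_lt (n := n) (by linarith [hM n]) hy'
      have h2 : (radixDigit M y' n : ℝ) ≤ M n := by exact_mod_cast h1.le
      have h3 : (0 : ℝ) ≤ radixDigit M y n := Nat.cast_nonneg _
      linarith
    have hy_le : P * |y - y'| ≤ 2 * (t / M n) := by
      have h1 := prod_mul_sub_eq_radixRem hy hy' hn
      have h2 := radixDigit_add_rem M hy n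
      have h3 := radixDigit_add_rem M hy' n
      have h4 := radixRem_mem M hy (n + 1)
      have h5 := radixRem_mem M hy' (n + 1)
      rw [← abs_of_pos hP, ← abs_mul, ← mul_div_assoc, le_div_iff₀ hMn, ← abs_of_pos hMn, ← abs_mul,
        h1, abs_le]
      constructor <;> nlinarith [h4.1, h4.2, h5.1, h5.2]
    have hx_ge : (ℓ n * Q) * (t / M n) ≤ |X y - X y'| := by
      have hk : ∀ k < n, a y k = a y' k := fun k hk => by simp only [a, hn k hk]
      have hij : a y n < a y' n := by
        rw [← PNat.coe_lt_coe, ha, ha]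
        omega
      have h1 := codes_sub_ge hf hm h0 (hX y) (hX y') hk
      have h2 := hgap n (a y n) (a y' n) (hblock y hy n).1 hij (hblock y' hy' n).2
      have h3 : (((a y' n : ℕ) : ℝ) - (a y n : ℕ)) = t := by
        rw [ha, ha, ht]
        push_cast
        ring
      rw [h3] at h2
      have hQr : Q ≤ ∏ k ∈ Finset.range n, r (a y k) :=
        Finset.prod_le_prod (fun k _ => hρ k) fun k _ =>
          hρr k _ (hblock y hy k).1 (hblock y hy k).2
      refine le_trans ?_ (le_abs_self _)
      refine le_trans ?_ h1
      rw [show ℓ n * Q * (t / M n) = Q * (ℓ n * (t / M n)) by ring]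
      exact mul_le_mul hQr h2 (mul_nonneg (hℓ n) (by positivity)) (hQ.trans hQr)
    have h1 : (ℓ n * Q) ^ s * (t / M n) ≤ |X y - X y'| ^ s := by
      refine le_trans ?_ (Real.rpow_le_rpow (by have := hℓ n; positivity) hx_ge hs.le)
      rw [Real.mul_rpow (mul_nonneg (hℓ n) hQ) (by positivity)]
      refine mul_le_mul_of_nonneg_left ?_ (Real.rpow_nonneg (mul_nonneg (hℓ n) hQ) _)
      exact Real.self_le_rpow_of_le_one (by positivity) htM hs1
    have h3 : c * (t / M n) ≤ P * |X y - X y'| ^ s :=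
      calc c * (t / M n) ≤ (ℓ n * Q) ^ s * P * (t / M n) :=
            mul_le_mul_of_nonneg_right (hprod n) (by positivity)
        _ = P * ((ℓ n * Q) ^ s * (t / M n)) := by ring
        _ ≤ _ := mul_le_mul_of_nonneg_left h1 hP.le
    rw [div_mul_eq_mul_div, le_div_iff₀ hc]
    refine le_of_mul_le_mul_left ?_ hP
    nlinarith
  have hXY : ∀ y ∈ Ico (0 : ℝ) 1, ∀ y' ∈ Ico (0 : ℝ) 1,
      |y - y'| ≤ 2 / c * |X y - X y'| ^ s := by
    intro y hy y' hy'
    rcases eq_or_ne y y' with rfl | hne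
    · simp [hs.ne']
    have hex := exists_radixDigit_ne hM hy hy' hne
    classical
    have hlt : ∀ k < Nat.find hex, radixDigit M y k = radixDigit M y' k := fun k hk =>
      not_not.1 (Nat.find_min hex hk)
    rcases (Nat.find_spec hex).lt_or_gt with h | h
    · exact key y hy y' hy' _ hlt h
    · rw [abs_sub_comm y, abs_sub_comm (X y)]
      exact key y' hy' y hy _ (fun k hk => (hlt k hk).symm) h
  have hinj : InjOn X (Ico 0 1) := by
    intro y hy y' hy' h
    have := hXY y hy y' hy'
    rw [h, sub_self, abs_zero, Real.zero_rpow hs.ne', mul_zero] at this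
    exact sub_eq_zero.1 (abs_nonpos_iff.1 this)
  have hinv := hinj.leftInvOn_invFunOn
  set g := Function.invFunOn X (Ico 0 1)
  have hhol : HolderOnWith (2 / c).toNNReal s.toNNReal g (X '' Ico 0 1) := by
    rintro _ ⟨y, hy, rfl⟩ _ ⟨y', hy', rfl⟩
    rw [hinv hy, hinv hy', edist_dist, edist_dist, Real.dist_eq, Real.dist_eq,
      Real.coe_toNNReal _ hs.le, ENNReal.ofReal_rpow_of_nonneg (abs_nonneg _) hs.le]
    change _ ≤ ENNReal.ofReal _ * _
    rw [← ENNReal.ofReal_mul (by positivity)]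
    exact ENNReal.ofReal_le_ofReal (hXY y hy y' hy')
  have hdim := hhol.dimH_image_le (Real.toNNReal_pos.2 hs)
  rw [hinv.image_image, Real.dimH_of_nonempty_interior (by simp), Module.finrank_self,
    Nat.cast_one, ENNReal.le_div_iff_mul_le (Or.inl (by simpa using hs)) (Or.inl (by simp)),
    one_mul] at hdim
  refine hdim.trans (dimH_mono ?_)
  rintro _ ⟨y, hy, rfl⟩
  exact ⟨a y, hblock y hy, hX y⟩

theorem exists_pos_le_prod_range {v : ℕ → ℝ} (hv : ∀ n, 0 < v n) (h : ∀ᶠ n in atTop, 1 ≤ v n) :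
    ∃ c, 0 < c ∧ ∀ n, c ≤ ∏ k ∈ Finset.range n, v k := by
  obtain ⟨N, hN⟩ := eventually_atTop.1 h
  have hw : ∀ k, 0 < min 1 (v k) := fun k => lt_min one_pos (hv k)
  refine ⟨∏ k ∈ Finset.range N, min 1 (v k), Finset.prod_pos fun k _ => hw k, fun n => ?_⟩
  refine le_trans ?_ (Finset.prod_le_prod (fun k _ => (hw k).le) fun k _ => min_le_right 1 (v k))
  have hanti : Antitone fun n => ∏ k ∈ Finset.range n, min 1 (v k) := by
    refine antitone_nat_of_succ_le fun n => ?_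
    rw [Finset.prod_range_succ]
    exact mul_le_of_le_one_right (Finset.prod_nonneg fun k _ => (hw k).le) (min_le_left _ _)
  rcases le_total n N with hn | hn
  · exact hanti hn
  · refine (Finset.prod_subset (Finset.range_subset_range.2 hn) fun k _ hk => ?_).le
    exact min_eq_left (hN k (by simpa using hk))

end DecayingIFS

namespace DecayingIFS

theorem isDecaying_powerAffine {d C : ℝ} (hd : 1 < d) (hC : 0 < C) (hC2 : C ≤ 1 / 2)
    {f : ℕ+ → ℝ → ℝ} {b : ℕ+ → ℝ} (hf : ∀ i x, f i x = C / ((i : ℕ) : ℝ) ^ d * x + b i)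
    (hm : ∀ i, MapsTo (f i) (Icc 0 1) (Icc 0 1))
    (hsep : ∀ i j : ℕ+, i < j → C / ((j : ℕ) : ℝ) ^ d + b j ≤ b i) : IsDecaying d f := by
  have hpow : ∀ i : ℕ+, 0 < ((i : ℕ) : ℝ) ^ d := fun i =>
    Real.rpow_pos_of_pos (Nat.cast_pos.2 i.pos) _
  have hone : ∀ i : ℕ+, (1 : ℝ) ≤ ((i : ℕ) : ℝ) := fun i => Nat.one_le_cast.2 i.pos
  have hr : ∀ i : ℕ+, 0 < C / ((i : ℕ) : ℝ) ^ d := fun i => div_pos hC (hpow i)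
  have hderiv : ∀ i, ∀ x ∈ Icc (0 : ℝ) 1,
      |derivWithin (f i) (Icc 0 1) x| = C / ((i : ℕ) : ℝ) ^ d := by
    intro i x hx
    have h : HasDerivAt (f i) (C / ((i : ℕ) : ℝ) ^ d) x := by
      rw [show f i = fun x => C / ((i : ℕ) : ℝ) ^ d * x + b i from funext (hf i)]
      simpa using ((hasDerivAt_id x).const_mul (C / ((i : ℕ) : ℝ) ^ d)).add_const (b i)
    rw [h.hasDerivWithinAt.derivWithin (uniqueDiffOn_Icc one_pos x hx), abs_of_pos (hr i)]
  have hlt : ∀ i j, i < j → f i '' Ioo 0 1 ∩ f j '' Ioo 0 1 = ∅ := by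
    intro i j hij
    refine eq_empty_of_forall_notMem ?_
    rintro _ ⟨⟨x, hx, rfl⟩, y, hy, hxy⟩
    rw [hf, hf] at hxy
    have h1 := hsep i j hij
    have h2 := mul_pos (hr i) hx.1
    have h3 := mul_lt_of_lt_one_right (hr j) hy.2
    linarith
  refine ⟨hd, hm, fun i => ?_, ⟨1, one_pos, C, hC, by linarith, fun a x hx => ?_⟩,
    fun i j hij => ?_, fun ε hε => ⟨C, C, hC, hC, fun i => ⟨_, _, fun x hx =>
      ⟨(hderiv i x hx).ge, (hderiv i x hx).le⟩, ?_, le_rfl, ?_⟩⟩⟩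
  · rw [show f i = fun x => C / ((i : ℕ) : ℝ) ^ d * x + b i from funext (hf i)]
    fun_prop
  · have : comp f a 1 = f (a 0) := rfl
    rw [this, hderiv _ x hx]
    exact ⟨hr _, div_le_self hC.le (Real.one_le_rpow (hone _) (by linarith))⟩
  · rcases lt_or_gt_of_ne hij with h | h
    · exact hlt i j h
    · rw [inter_comm]
      exact hlt j i h
  · exact div_le_div_of_nonneg_left hC.le (hpow i)
      (Real.rpow_le_rpow_of_exponent_le (hone i) (by linarith))
  · exact div_le_div_of_nonneg_left hC.le (Real.rpow_pos_of_pos (by linarith [hone i]) _)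
      (Real.rpow_le_rpow_of_exponent_le (hone i) (by linarith))

/-- Intervals of length `C / i ^ d` can be placed in `[0,1]` from right to left with the gap between
the `i`-th and the `j`-th one at least the decrease of a given sequence `T` from `i` to `j`. -/
theorem exists_offsets {d : ℝ} (hd : 1 < d) {T : ℕ → ℝ} (hT : Antitone T) (hT0 : ∀ i, 0 ≤ T i)
    (hT1 : T 0 ≤ 1 / 2) :
    ∃ C : ℝ, 0 < C ∧ C ≤ 1 / 2 ∧ ∃ b : ℕ+ → ℝ, (∀ i, 0 ≤ b i) ∧
      (∀ i : ℕ+, C / ((i : ℕ) : ℝ) ^ d + b i ≤ 1) ∧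
      ∀ i j : ℕ+, i < j → T i - T j ≤ b i - (C / ((j : ℕ) : ℝ) ^ d + b j) := by
  have hsum : Summable fun n : ℕ => 1 / ((n + 1 : ℕ) : ℝ) ^ d :=
    (summable_nat_add_iff 1).2 (Real.summable_one_div_nat_rpow.2 hd)
  have hterm : ∀ n : ℕ, 0 ≤ 1 / ((n + 1 : ℕ) : ℝ) ^ d := fun n => by positivity
  obtain ⟨D, hDsucc, hD0⟩ : ∃ D : ℕ → ℝ,
      (∀ n, D n = 1 / ((n + 1 : ℕ) : ℝ) ^ d + D (n + 1)) ∧ ∀ n, 0 ≤ D n := by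
    refine ⟨fun n => ∑' k : ℕ, 1 / ((k + n + 1 : ℕ) : ℝ) ^ d, fun n => ?_,
      fun n => tsum_nonneg fun k => hterm (k + n)⟩
    have h := ((summable_nat_add_iff n).2 hsum).tsum_eq_zero_add
    simp only [zero_add] at h
    simp only
    rw [h]
    congr 1
    refine tsum_congr fun k => ?_
    rw [show k + 1 + n + 1 = k + (n + 1) + 1 by ring]
  have hDanti : Antitone D := antitone_nat_of_succ_le fun n => by
    rw [hDsucc n]
    exact le_add_of_nonneg_left (hterm n)
  have hD1 : 1 ≤ D 0 := by
    rw [hDsucc 0]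
    simpa using hD0 1
  have hC : 0 < 1 / (2 * D 0) := by positivity
  have htop : ∀ i : ℕ+, 1 / (2 * D 0) / ((i : ℕ) : ℝ) ^ d + (1 / (2 * D 0) * D i + T i)
      = 1 / (2 * D 0) * D (i.natPred) + T i := by
    intro i
    rw [hDsucc i.natPred, PNat.natPred_add_one]
    ring
  refine ⟨1 / (2 * D 0), hC, ?_, fun i => 1 / (2 * D 0) * D i + T i, fun i => ?_, fun i => ?_,
    fun i j hij => ?_⟩
  · exact one_div_le_one_div_of_le two_pos (by linarith)
  · exact add_nonneg (mul_nonneg hC.le (hD0 _)) (hT0 _)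
  · rw [htop]
    have h1 : 1 / (2 * D 0) * D i.natPred ≤ 1 / (2 * D 0) * D 0 :=
      mul_le_mul_of_nonneg_left (hDanti (Nat.zero_le _)) hC.le
    have h2 : 1 / (2 * D 0) * D 0 = 1 / 2 := by field_simp
    linarith [hT (Nat.zero_le (i : ℕ))]
  · rw [htop]
    have h : D j.natPred ≤ D i := hDanti (by
      have := PNat.natPred_add_one j
      have : (i : ℕ) < j := hij
      omega)
    have := mul_le_mul_of_nonneg_left h hC.le
    linarith

/-- There is a decreasing sequence that falls at the constant rate `2 ^ (-(n + 2)) / M n`, or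
faster, on each of the blocks `[M n, 2 * M n]`. -/
theorem exists_block_decreasing {M : ℕ → ℕ} (hM : ∀ n, 0 < M n) :
    ∃ T : ℕ → ℝ, Antitone T ∧ (∀ i, 0 ≤ T i) ∧ T 0 ≤ 1 / 2 ∧
      ∀ n i j : ℕ, M n ≤ i → i ≤ j → j ≤ 2 * M n →
        (1 / 2) ^ (n + 2) * (((j : ℝ) - i) / M n) ≤ T i - T j := by
  let τ : ℕ → ℕ → ℝ := fun m i => max 0 (min 1 ((2 * m - i : ℝ) / m))
  have hτ0 : ∀ m i, 0 ≤ τ m i := fun m i => le_max_left _ _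
  have hτ1 : ∀ m i, τ m i ≤ 1 := fun m i => max_le zero_le_one (min_le_left _ _)
  have hτ : ∀ m, Antitone (τ m) := by
    intro m i j hij
    have : (i : ℝ) ≤ j := by exact_mod_cast hij
    simp only [τ]
    gcongr
  have hτ_eq : ∀ m i : ℕ, 0 < m → m ≤ i → i ≤ 2 * m → τ m i = (2 * m - i : ℝ) / m := by
    intro m i hm h1 h2
    have hm' : (0 : ℝ) < m := by exact_mod_cast hm
    have h1' : (m : ℝ) ≤ i := by exact_mod_cast h1
    have h2' : (i : ℝ) ≤ 2 * m := by exact_mod_cast h2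
    simp only [τ]
    rw [min_eq_right, max_eq_right]
    · exact div_nonneg (by linarith) hm'.le
    · rw [div_le_one hm']
      linarith
  have hgeom : HasSum (fun n : ℕ => (1 / 2 : ℝ) ^ (n + 2)) (1 / 2) := by
    have := hasSum_geometric_two.mul_left (1 / 4 : ℝ)
    convert! this using 1
    · ext n
      ring
    · norm_num
  have hsum : ∀ i, Summable fun n => (1 / 2 : ℝ) ^ (n + 2) * τ (M n) i := fun i =>
    hgeom.summable.of_nonneg_of_le (fun n => mul_nonneg (by positivity) (hτ0 _ _))
      fun n => mul_le_of_le_one_right (by positivity) (hτ1 _ _)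
  refine ⟨fun i => ∑' n, (1 / 2 : ℝ) ^ (n + 2) * τ (M n) i, fun i j hij => ?_, fun i => ?_, ?_,
    fun n i j hi hij hj => ?_⟩
  · exact (hsum j).tsum_le_tsum (fun n => mul_le_mul_of_nonneg_left (hτ _ hij) (by positivity))
      (hsum i)
  · exact tsum_nonneg fun n => mul_nonneg (by positivity) (hτ0 _ _)
  · exact ((hsum 0).tsum_le_tsum (fun n => mul_le_of_le_one_right (by positivity) (hτ1 _ _))
      hgeom.summable).trans_eq hgeom.tsum_eq
  · rw [← (hsum i).tsum_sub (hsum j)]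
    refine le_trans (le_of_eq ?_) (((hsum i).sub (hsum j)).le_tsum n fun k _ => ?_)
    · rw [hτ_eq _ _ (hM n) hi (hij.trans hj), hτ_eq _ _ (hM n) (hi.trans hij) hj]
      ring
    · rw [sub_nonneg]
      exact mul_le_mul_of_nonneg_left (hτ _ hij) (by positivity)

end DecayingIFS

namespace DecayingIFS

theorem mapsTo_powerAffine {d C : ℝ} (hC : 0 < C)
    {f : ℕ+ → ℝ → ℝ} {b : ℕ+ → ℝ} (hf : ∀ i x, f i x = C / ((i : ℕ) : ℝ) ^ d * x + b i)
    (hb0 : ∀ i, 0 ≤ b i) (hb1 : ∀ i : ℕ+, C / ((i : ℕ) : ℝ) ^ d + b i ≤ 1) (i : ℕ+) :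
    MapsTo (f i) (Icc 0 1) (Icc 0 1) := by
  intro x hx
  have hr : 0 ≤ C / ((i : ℕ) : ℝ) ^ d := by positivity
  rw [hf]
  exact ⟨add_nonneg (mul_nonneg hr hx.1) (hb0 i),
    (add_le_add_left (mul_le_of_le_one_right hr hx.2) _).trans (hb1 i)⟩

theorem dimH_growthSet_le {d C : ℝ} (hd : 1 < d) (hC : 0 < C) (hC2 : C ≤ 1 / 2)
    {f : ℕ+ → ℝ → ℝ} {b : ℕ+ → ℝ} (hf : ∀ i x, f i x = C / ((i : ℕ) : ℝ) ^ d * x + b i)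
    (hm : ∀ i, MapsTo (f i) (Icc 0 1) (Icc 0 1))
    {Φ : ℕ+ → ℝ} (hΦ : ∀ i : ℕ+, ((i : ℕ) : ℝ) ≤ Φ i) :
    dimH (growthSet f Φ) ≤ ENNReal.ofReal (1 / d) := by
  have hr0 : ∀ i : ℕ+, 0 ≤ C / ((i : ℕ) : ℝ) ^ d := fun i => by positivity
  have hr2 : ∀ i : ℕ+, C / ((i : ℕ) : ℝ) ^ d ≤ 1 / 2 := fun i =>
    (div_le_self hC.le (Real.one_le_rpow (Nat.one_le_cast.2 i.pos) (by linarith))).trans hC2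
  refine dimH_le fun s hs => ?_
  by_contra! hlt
  rw [← ENNReal.ofReal_coe_nnreal, ENNReal.ofReal_lt_ofReal_iff_of_nonneg (by positivity)] at hlt
  have hs0 : 0 < (s : ℝ) := lt_trans (by positivity) hlt
  have hds : 1 < d * s := by
    rwa [div_lt_iff₀' (by linarith)] at hlt
  have hsum : Summable fun i : ℕ+ => (C / ((i : ℕ) : ℝ) ^ d) ^ (s : ℝ) := by
    have h := ((Real.summable_one_div_nat_rpow.2 hds).mul_left (C ^ (s : ℝ))).comp_injective
      PNat.coe_injective
    refine h.congr fun i => ?_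
    rw [Function.comp_apply, Real.div_rpow hC.le (by positivity), ← Real.rpow_mul (by positivity)]
    ring
  have hnull := hausdorffMeasure_growing_eq_zero hf hm hr0 hr2 hs0 hsum
  have hsub : growthSet f Φ ⊆ {x : ℝ | ∃ a : ℕ → ℕ+, (∀ k, k < (a k : ℕ)) ∧ Codes f a x} := by
    rintro x ⟨a, ha, hx⟩
    refine ⟨a, fun k => ?_, hx⟩
    induction k with
    | zero => exact (a 0).pos
    | succ k ih =>
      have : (a k : ℕ) < a (k + 1) := by exact_mod_cast (hΦ (a k)).trans_lt (ha k)
      omega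
  rw [measure_mono_null hsub hnull] at hs
  exact ENNReal.zero_ne_top hs

theorem le_dimH_of_separated_blocks {d C : ℝ} (hd : 1 < d) (hC : 0 < C) (hC2 : C ≤ 1 / 2)
    {f : ℕ+ → ℝ → ℝ} {b : ℕ+ → ℝ} (hf : ∀ i x, f i x = C / ((i : ℕ) : ℝ) ^ d * x + b i)
    (hm : ∀ i, MapsTo (f i) (Icc 0 1) (Icc 0 1)) {M : ℕ → ℕ} (hM : ∀ n, 2 ≤ M n)
    (hM_lim : Tendsto M atTop atTop)
    (hgap : ∀ n, ∀ i j : ℕ+, M n < i → i < j → j ≤ 2 * M n →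
      (1 / 2) ^ (n + 2) * (((j : ℕ) - (i : ℕ) : ℝ) / M n)
        ≤ b i - (C / ((j : ℕ) : ℝ) ^ d + b j)) :
    ENNReal.ofReal (1 / d) ≤
      dimH {x : ℝ | ∃ a : ℕ → ℕ+, (∀ n, M n < a n ∧ a n ≤ 2 * M n) ∧ Codes f a x} := by
  have hr0 : ∀ i : ℕ+, 0 ≤ C / ((i : ℕ) : ℝ) ^ d := fun i => by positivity
  have hr2 : ∀ i : ℕ+, C / ((i : ℕ) : ℝ) ^ d ≤ 1 / 2 := fun i =>
    (div_le_self hC.le (Real.one_le_rpow (Nat.one_le_cast.2 i.pos) (by linarith))).trans hC2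
  by_contra! hlt
  obtain ⟨s, hs1, hs2⟩ := ENNReal.lt_iff_exists_nnreal_btwn.1 hlt
  refine hs1.not_ge ?_
  rw [← ENNReal.ofReal_coe_nnreal] at hs1 hs2 ⊢
  have hs0 : 0 < (s : ℝ) := ENNReal.ofReal_pos.1 (bot_le.trans_lt hs1)
  have hsd : (s : ℝ) * d < 1 := by
    rw [ENNReal.ofReal_lt_ofReal_iff (by positivity), lt_div_iff₀ (by linarith)] at hs2
    exact hs2
  have hMpos : ∀ n, (0 : ℝ) < M n := fun n => by have := hM n; positivity
  let ρ : ℕ → ℝ := fun n => C / (2 * M n : ℝ) ^ d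
  have hρ : ∀ n, 0 < ρ n := fun n => by have := hMpos n; positivity
  have hρr : ∀ n, ∀ i : ℕ+, M n < i → i ≤ 2 * M n → ρ n ≤ C / ((i : ℕ) : ℝ) ^ d := by
    intro n i _ hi
    have hi' : ((i : ℕ) : ℝ) ≤ 2 * M n := by exact_mod_cast hi
    have : (0 : ℝ) < (i : ℕ) := Nat.cast_pos.2 i.pos
    exact div_le_div_of_nonneg_left hC.le (by positivity)
      (Real.rpow_le_rpow this.le hi' (by linarith))
  obtain ⟨c, hc, hcle⟩ : ∃ c : ℝ, 0 < c ∧ ∀ n,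
      c ≤ ∏ k ∈ Finset.range n, ((1 / 2 * ρ k) ^ (s : ℝ) * M k) := by
    refine exists_pos_le_prod_range
      (fun n => mul_pos (Real.rpow_pos_of_pos (by have := hρ n; positivity) _) (hMpos n)) ?_
    have heq : ∀ n, (1 / 2 * ρ n) ^ (s : ℝ) * M n
        = (1 / 2 * (C / 2 ^ d)) ^ (s : ℝ) * (M n : ℝ) ^ (1 - s * d) := by
      intro n
      have hMn := hMpos n
      have h1 : 1 / 2 * ρ n = 1 / 2 * (C / 2 ^ d) * (M n : ℝ) ^ (-d) := by
        simp only [ρ]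
        rw [Real.mul_rpow two_pos.le hMn.le, Real.rpow_neg hMn.le]
        field_simp
      rw [h1, Real.mul_rpow (by positivity) (by positivity), ← Real.rpow_mul hMn.le, mul_assoc,
        ← Real.rpow_add_one hMn.ne']
      ring_nf
    have hlim : Tendsto (fun n => (1 / 2 * ρ n) ^ (s : ℝ) * M n) atTop atTop := by
      simp_rw [heq]
      refine Tendsto.const_mul_atTop (by positivity) ?_
      exact (tendsto_rpow_atTop (by linarith)).comp (tendsto_natCast_atTop_atTop.comp hM_lim)
    exact hlim.eventually_ge_atTop 1
  refine ofReal_le_dimH_of_block_gaps (c := (1 / 4) ^ (s : ℝ) * c) hf hm hr0 hr2 hM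
    (fun n => by positivity) (fun n => (hρ n).le) hρr hgap hs0 (by nlinarith) (by positivity)
    fun n => ?_
  have hprod : ((1 / 2 : ℝ) ^ (n + 2) * ∏ k ∈ Finset.range n, ρ k)
      = 1 / 4 * ∏ k ∈ Finset.range n, (1 / 2 * ρ k) := by
    rw [Finset.prod_mul_distrib, Finset.prod_const, Finset.card_range]
    ring
  have hnn : ∀ k ∈ Finset.range n, 0 ≤ 1 / 2 * ρ k := fun k _ => by have := hρ k; positivity
  rw [hprod, Real.mul_rpow (by norm_num) (Finset.prod_nonneg hnn), mul_assoc]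
  refine mul_le_mul_of_nonneg_left ?_ (by positivity)
  rw [← Real.finsetProd_rpow _ _ hnn, ← Finset.prod_mul_distrib]
  exact hcle n

theorem exists_system_dimH_growthSet {d : ℝ} (hd : 1 < d) {Φ : ℕ+ → ℕ+} (hΦ : StrictMono Φ) :
    ∃ f : ℕ+ → ℝ → ℝ, IsDecaying d f ∧ IsPowerAffine d f ∧ HasGaps f ∧
      dimH (growthSet f fun n => ((Φ n : ℕ) : ℝ)) = ENNReal.ofReal (1 / d) := by
  have hΦle : ∀ i, i ≤ Φ i := fun i => hΦ.le_apply
  obtain ⟨m, hm0, hmsucc⟩ : ∃ m : ℕ → ℕ+, m 0 = 2 ∧ ∀ n, m (n + 1) = Φ (2 * m n) :=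
    ⟨fun n => Nat.rec 2 (fun _ i => Φ (2 * i)) n, rfl, fun _ => rfl⟩
  have hmono : StrictMono fun n : ℕ => (m n : ℕ) := by
    refine strictMono_nat_of_lt_succ fun n => ?_
    have h1 : ((2 * m n : ℕ+) : ℕ) ≤ (m (n + 1) : ℕ) := hmsucc n ▸ hΦle _
    have h2 := (m n).pos
    rw [PNat.mul_coe, PNat.val_ofNat] at h1
    omega
  have hm2 : ∀ n, 2 ≤ (m n : ℕ) := fun n => by
    have h : (m 0 : ℕ) ≤ m n := hmono.monotone (Nat.zero_le n)
    rwa [hm0] at h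
  obtain ⟨T, hT, hT0, hT1, hTblock⟩ :=
    exists_block_decreasing (M := fun n => (m n : ℕ)) fun n => (m n).pos
  obtain ⟨C, hC, hC2, b, hb0, hb1, hsep⟩ := exists_offsets hd hT hT0 hT1
  let f : ℕ+ → ℝ → ℝ := fun i x => C / ((i : ℕ) : ℝ) ^ d * x + b i
  have hf : ∀ i x, f i x = C / ((i : ℕ) : ℝ) ^ d * x + b i := fun _ _ => rfl
  have hmaps := mapsTo_powerAffine hC hf hb0 hb1
  have hord : ∀ i j : ℕ+, i < j → C / ((j : ℕ) : ℝ) ^ d + b j ≤ b i := fun i j hij => by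
    have h1 := hsep i j hij
    have h2 := hT (PNat.coe_le_coe _ _ |>.2 hij.le)
    linarith
  have hlow : ∀ i, ∀ y ∈ Icc (0 : ℝ) 1, b i ≤ f i y := fun i y hy => by
    have h : 0 ≤ C / ((i : ℕ) : ℝ) ^ d * y := mul_nonneg (by positivity) hy.1
    rw [hf]
    linarith
  have hup : ∀ i, ∀ x ∈ Icc (0 : ℝ) 1, f i x ≤ C / ((i : ℕ) : ℝ) ^ d + b i := fun i x hx => by
    have h : C / ((i : ℕ) : ℝ) ^ d * x ≤ C / ((i : ℕ) : ℝ) ^ d :=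
      mul_le_of_le_one_right (by positivity) hx.2
    rw [hf]
    linarith
  have hsucc : ∀ i : ℕ+, i < i + 1 := fun i => PNat.lt_add_right i 1
  refine ⟨f, isDecaying_powerAffine hd hC hC2 hf hmaps hord, ⟨C, hC, b, fun i x _ => rfl⟩,
    ⟨fun i x hx y hy => (hup _ x hx).trans ((hord i _ (hsucc i)).trans (hlow i y hy)),
      fun N => ⟨m N, ?_, C / (((m N + 1 : ℕ+) : ℕ) : ℝ) ^ d + b (m N + 1), b (m N), ?_,
        hup _, hlow _⟩⟩, le_antisymm ?_ ?_⟩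
  · exact (PNat.coe_le_coe _ _).1 (hmono.le_apply (x := (N : ℕ)))
  · have h1 := hsep _ _ (hsucc (m N))
    have h2 := hTblock N (m N) (m N + 1) le_rfl (by omega) (by have := hm2 N; omega)
    have h3 : (0 : ℝ) < (m N : ℕ) := Nat.cast_pos.2 (m N).pos
    rw [PNat.add_coe, PNat.one_coe] at h1 ⊢
    have h4 : (0 : ℝ) < (1 / 2) ^ ((N : ℕ) + 2) *
        ((((m N : ℕ) + 1 : ℕ) - (m N : ℕ) : ℝ) / (m N : ℕ)) := by
      push_cast
      rw [add_sub_cancel_left]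
      positivity
    linarith
  · exact dimH_growthSet_le hd hC hC2 hf hmaps fun i => by exact_mod_cast hΦle i
  · refine (le_dimH_of_separated_blocks hd hC hC2 hf hmaps (M := fun n => (m n : ℕ)) hm2
      hmono.tendsto_atTop
      fun n i j hi hij hj => ?_).trans (dimH_mono ?_)
    · exact (hTblock n i j hi.le (PNat.coe_le_coe _ _ |>.2 hij.le) hj).trans (hsep i j hij)
    · rintro x ⟨a, ha, hx⟩
      refine ⟨a, fun n => ?_, hx⟩
      have h1 : a n ≤ 2 * m n := by
        rw [← PNat.coe_le_coe, PNat.mul_coe]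
        exact (ha n).2
      have h2 : (Φ (a n) : ℕ) ≤ m (n + 1) := hmsucc n ▸ hΦ.monotone h1
      exact Nat.cast_lt.2 (h2.trans_lt (ha (n + 1)).1)

theorem growthSet_anti (f : ℕ+ → ℝ → ℝ) : Antitone (growthSet f) := by
  rintro Φ Ψ h x ⟨a, ha, hx⟩
  exact ⟨a, fun n => (h _).trans_lt (ha n), hx⟩

end DecayingIFS

theorem theorem4 :
    (∀ d : ℝ, 1 < d → ∀ Φ : ℕ+ → ℕ+, StrictMono Φ →
      ∃ f : ℕ+ → ℝ → ℝ,
        DecayingIFS.IsDecaying d f ∧ DecayingIFS.IsPowerAffine d f ∧ DecayingIFS.HasGaps f ∧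
        dimH (DecayingIFS.growthSet f (fun n => ((Φ n : ℕ) : ℝ))) = ENNReal.ofReal (1 / d)) ∧
    (∀ d : ℝ, 1 < d → ∀ α : ℝ, 1 < α →
      ∃ f : ℕ+ → ℝ → ℝ,
        DecayingIFS.IsDecaying d f ∧ DecayingIFS.IsPowerAffine d f ∧ DecayingIFS.HasGaps f ∧
        dimH (DecayingIFS.growthSet f (fun n => ((n : ℕ) : ℝ) ^ α)) ≠
          ENNReal.ofReal (1 / (1 + α * (d - 1)))) := by
  refine ⟨fun d hd Φ hΦ => DecayingIFS.exists_system_dimH_growthSet hd hΦ, fun d hd α hα => ?_⟩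
  have hk : ⌈α⌉₊ ≠ 0 := (Nat.ceil_pos.2 (by linarith)).ne'
  obtain ⟨f, hdec, haff, hgaps, hdim⟩ := DecayingIFS.exists_system_dimH_growthSet hd
    (Φ := fun n => n ^ ⌈α⌉₊) (fun i j hij => by
      rw [← PNat.coe_lt_coe, PNat.pow_coe, PNat.pow_coe]
      exact Nat.pow_lt_pow_left hij hk)
  refine ⟨f, hdec, haff, hgaps, ne_of_gt ?_⟩
  refine lt_of_lt_of_le ?_ (hdim.ge.trans (dimH_mono (DecayingIFS.growthSet_anti f fun n => ?_)))
  · rw [ENNReal.ofReal_lt_ofReal_iff (by positivity)]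
    exact one_div_lt_one_div_of_lt (by linarith) (by nlinarith)
  · rw [PNat.pow_coe, Nat.cast_pow, ← Real.rpow_natCast]
    exact Real.rpow_le_rpow_of_exponent_le (Nat.one_le_cast.2 n.pos) (Nat.le_ceil α)
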